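/- **Setting.** $(A,\alpha)$ and $(B,\beta)$ are von Neumann algebras with faithful normal trace-states, and $A\subset B$ is a unital inclusion with $\beta|_A=\alpha$. For a von Neumann algebra $(M,\tau)$ with faithful normal trace-state, $M_h$ is the set of self-adjoint elements of $M$ and $L^1(M,\tau)$ is the completion of $M$ for $\|x\|_1=\tau(|x|)$; $L^1(M_h,\tau)$ is the $L^1$-closure of $M_h$. For $P\in\mathbb C\langle X_1,\dots,X_n\rangle$ the cyclic gradient is $\delta P=(\delta_jP)_{1\le j\le n}$, where $\delta_j$ is the linear map with $$\delta_j(X_{i_1}\cdots X_{i_p})=\sum_{k:\,i_k=j}X_{i_{k+1}}\cdots X_{i_p}X_{i_1}\cdots X_{i_{k-1}},$$ and $\delta\mathbb C_{\langle n\rangle}(Y)=\{((\delta_jP)(Y))_{j}: P\in\mathbb C\langle X_1,\dots,X_n\rangle\}$ for $Y\in M^n$. *Real cyclomorphic maps.* Let $\Omega\subset M_h^n$ be norm-open. A differentiable function $f:\Omega\to\mathbb R$ is $\mathbb R$-cyclomorphic if for every $Y\in\Omega$ there is $T\in L^1(M_h,\tau)^n$, lying in the $L^1$-closure of $\delta\mathbb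 C_{\langle n\rangle}(Y)\cap M_h^n$, such that $df[Y](K)=\sum_{j}\tau(T_jK_j)$ for all $K\in M_h^n$. A differentiable map $F:\Omega\to N_h^p$ is $\mathbb R$-cyclomorphic if, for every norm-open $\omega\subset N_h^p$ and every $\mathbb R$-cyclomorphic $f:\omega\to\mathbb R$, the function $f\circ F:\Omega\cap F^{-1}(\omega)\to\mathbb R$ is $\mathbb R$-cyclomorphic. *Complex cyclomorphic maps.* Let $\Theta\subset M^n$ be norm-open. A complex-analytic function $h:\Theta\to\mathbb C$ is $\mathbb C$-cyclomorphic if for every $Z\in\Theta$ there is $S\in L^1(M,\tau)^n$, lying in the $L^1$-closure of $\delta\mathbb C_{\langle n\rangle}(Z)$, such that $dh[Z](W)=\sum_j\tau(S_jW_j)$ for all $W\in M^n$. A complex-analytic map $H:\Theta\to N^p$ is $\mathbb C$-cyclomorphic if, for every norm-open $\theta\subset N^p$ and every $\mathbb C$-cyclomorphic $h:\theta\to\mathbb C$, the function $h\circ H:\Theta\cap H^{-1}(\theta)\to\mathbb C$ is $\mathbb C$-cyclomorphic. *Independence.* Let $\mathcal Z\subset B$ be the unital subalgebra generated by a finite tuple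 in $B$. The tuple is independent from $A$ if $az=za$ and $\beta(az)=\beta(a)\beta(z)$ for all $a\in A$, $z\in\mathcal Z$. It is freely independent from $A$ if $\beta(b_1\cdots b_k)=0$ whenever $k\ge1$, $\beta(b_i)=0$ for all $i$, and the $b_i$ are taken alternately from $A$ and $\mathcal Z$. **Theorem.** Let $n,m\ge0$. 1. If $Z=(Z_1,\dots,Z_m)\in B_h^m$ is independent or freely independent from $A$, then the map $\Phi_Z:A_h^n\to B_h^{n+m}$, $(Y_1,\dots,Y_n)\mapsto(Y_1,\dots,Y_n,Z_1,\dots,Z_m)$, is $\mathbb R$-cyclomorphic. 2. If $W=(W_1,\dots,W_m)\in B^m$ is independent or freely independent from $A$, then the map $\Xi_W:A^n\to B^{n+m}$, $(Z_1,\dots,Z_n)\mapsto(Z_1,\dots,Z_n,W_1,\dots,W_m)$, is $\mathbb C$-cyclomorphic. -/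

import Mathlib

/-! ### Faithful normal trace-states -/

section TraceState

open scoped ComplexOrder

/-- A faithful normal trace-state on a (von Neumann) algebra `M`.
Normality is preservation of suprema of bounded increasing nets of self-adjoint elements. -/
structure TraceState (M : Type*) [CStarAlgebra M] [PartialOrder M] [StarOrderedRing M]
    extends M →ₗ[ℂ] ℂ where
  map_one' : toFun 1 = 1
  map_star_mul_self_nonneg' : ∀ x : M, 0 ≤ toFun (star x * x)
  map_mul_comm' : ∀ x y : M, toFun (x * y) = toFun (y * x)
  faithful' : ∀ x : M, toFun (star x * x) = 0 → x = 0
  normal' : ∀ (S : Set M) (x : M), S.Nonempty → DirectedOn (· ≤ ·) S →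
    (∀ s ∈ S, IsSelfAdjoint s) → IsLUB S x → IsLUB ((fun s => (toFun s).re) '' S) (toFun x).re

namespace TraceState

variable {M : Type*} [CStarAlgebra M] [PartialOrder M] [StarOrderedRing M]

instance : FunLike (TraceState M) M ℂ where
  coe τ := τ.toFun
  coe_injective τ τ' h := by
    cases τ; cases τ'
    congr
    exact DFunLike.coe_injective h

instance : LinearMapClass (TraceState M) ℂ M ℂ where
  map_add τ := τ.map_add'
  map_smulₛₗ τ := τ.map_smul'

variable (τ : TraceState M)

theorem map_mul_comm (x y : M) : τ (x * y) = τ (y * x) := τ.map_mul_comm' x y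

theorem nonneg_of_nonneg {x : M} (hx : 0 ≤ x) : 0 ≤ τ x := by
  obtain ⟨y, rfl⟩ := CStarAlgebra.nonneg_iff_eq_star_mul_self.mp hx
  exact τ.map_star_mul_self_nonneg' y

theorem mono {x y : M} (h : x ≤ y) : (τ x).re ≤ (τ y).re := by
  have := τ.nonneg_of_nonneg (sub_nonneg.mpr h)
  rw [map_sub] at this
  have := (Complex.le_def.mp this).1
  simpa using this

/-- The trace as a positive linear functional. -/
noncomputable def toPositive : M →ₚ[ℂ] ℂ :=
  PositiveLinearMap.mk₀ τ.toLinearMap fun _ hx => τ.nonneg_of_nonneg hx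

theorem norm_map_mul_le_of_nonneg {h : M} (hh : 0 ≤ h) (z : M) : ‖τ (h * z)‖ ≤ ‖z‖ * (τ h).re := by
  have hs : IsSelfAdjoint (CFC.sqrt h) := (CFC.sqrt_nonneg h).isSelfAdjoint
  have hsq : CFC.sqrt h * CFC.sqrt h = h := CFC.sqrt_mul_sqrt_self h
  have h0 : 0 ≤ (τ h).re := by simpa using τ.mono hh
  have key := norm_inner_le_norm (𝕜 := ℂ) (τ.toPositive.toPreGNS (CFC.sqrt h))
    (τ.toPositive.toPreGNS (CFC.sqrt h * z))
  rw [PositiveLinearMap.preGNS_inner_def, PositiveLinearMap.preGNS_norm_def,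
    PositiveLinearMap.preGNS_norm_def] at key
  simp only [PositiveLinearMap.ofPreGNS_toPreGNS] at key
  change ‖τ (star (CFC.sqrt h) * (CFC.sqrt h * z))‖ ≤ √(τ (star (CFC.sqrt h) * CFC.sqrt h)).re *
    √(τ (star (CFC.sqrt h * z) * (CFC.sqrt h * z))).re at key
  rw [hs.star_eq, ← mul_assoc, hsq] at key
  have h2 : (τ (star (CFC.sqrt h * z) * (CFC.sqrt h * z))).re ≤ ‖z‖ ^ 2 * (τ h).re := by
    have e : τ (star (CFC.sqrt h * z) * (CFC.sqrt h * z)) =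
        τ (star (CFC.sqrt h) * (z * star z) * CFC.sqrt h) := by
      rw [star_mul, hs.star_eq, mul_assoc, τ.map_mul_comm]
      simp only [← mul_assoc]
      rw [hsq, τ.map_mul_comm (CFC.sqrt h * z * star z)]
      simp only [← mul_assoc, hsq]
    rw [e]
    have := τ.mono (CStarAlgebra.star_left_conjugate_le_norm_smul (a := CFC.sqrt h)
      (b := z * star z) (IsSelfAdjoint.mul_star_self z))
    rw [hs.star_eq, hsq, CStarRing.norm_self_mul_star, ← Complex.coe_smul, map_smul, smul_eq_mul,
      Complex.re_ofReal_mul] at this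
    rw [hs.star_eq, sq]
    exact this
  calc ‖τ (h * z)‖ ≤ _ := key
    _ ≤ √(τ h).re * √(‖z‖ ^ 2 * (τ h).re) := by gcongr
    _ = ‖z‖ * (τ h).re := by
      rw [Real.sqrt_mul (sq_nonneg _), Real.sqrt_sq (norm_nonneg _), mul_left_comm,
        Real.mul_self_sqrt h0]

/-- Approximate polar decomposition. -/
theorem exists_approx_polar (x : M) {ε : ℝ} (hε : 0 < ε) :
    ∃ u : M, ‖u‖ ≤ 1 ∧ x = u * (CFC.abs x + algebraMap ℝ M ε) ∧
      CFC.abs x ≤ star u * x + algebraMap ℝ M ε := by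
  set a := CFC.abs x with ha
  have ha0 : 0 ≤ a := CFC.abs_nonneg x
  have hsa : IsSelfAdjoint a := ha0.isSelfAdjoint
  have hspec : ∀ t ∈ spectrum ℝ a, 0 ≤ t := fun t ht => spectrum_nonneg_of_nonneg ha0 ht
  have hxx : a * a = star x * x := CFC.abs_mul_abs x
  set g : ℝ → ℝ := fun t => (t + ε)⁻¹ with hg
  have hgc : ContinuousOn g (spectrum ℝ a) := by
    refine ContinuousOn.inv₀ (by fun_prop) fun t ht => ?_
    have := hspec t ht
    positivity
  set c := cfc g a with hc
  have hcs : IsSelfAdjoint c := cfc_predicate g a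
  have hca : c * (a + algebraMap ℝ M ε) = 1 := by
    have e : a + algebraMap ℝ M ε = cfc (fun t : ℝ => t + ε) a := by
      rw [cfc_add_const ε (fun t => t) a (by fun_prop), cfc_id' ℝ a]
    rw [e, hc, ← cfc_mul g _ a hgc (by fun_prop)]
    rw [← cfc_one ℝ a]
    refine cfc_congr fun t ht => ?_
    have := hspec t ht
    simp only [hg, Pi.one_apply]
    field_simp
  have hcaa : c * (a * a) = cfc (fun t : ℝ => g t * (t * t)) a := by
    have e : a * a = cfc (fun t : ℝ => t * t) a := by
      rw [cfc_mul (fun t : ℝ => t) (fun t => t) a, cfc_id' ℝ a]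
    rw [e, hc, ← cfc_mul g _ a hgc (by fun_prop)]
  refine ⟨x * c, ?_, ?_, ?_⟩
  · have e : star (x * c) * (x * c) = cfc (fun t : ℝ => g t * (t * t) * g t) a := by
      rw [cfc_mul (fun t => g t * (t * t)) g a (hgc.mul (by fun_prop)) hgc, ← hcaa, star_mul,
        hcs.star_eq, hxx]
      simp only [mul_assoc, hc]
    have h1 : ‖star (x * c) * (x * c)‖ ≤ 1 := by
      rw [e]
      refine norm_cfc_le zero_le_one fun t ht => ?_
      have := hspec t ht
      rw [Real.norm_eq_abs, abs_le]
      simp only [hg]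
      have h3 : (t + ε)⁻¹ * (t * t) * (t + ε)⁻¹ = (t / (t + ε)) ^ 2 := by field_simp
      rw [h3]
      have h4 : t / (t + ε) ≤ 1 := by rw [div_le_one (by positivity)]; linarith
      have h5 : 0 ≤ t / (t + ε) := by positivity
      constructor <;> nlinarith
    rw [CStarRing.norm_star_mul_self] at h1
    nlinarith [norm_nonneg (x * c)]
  · rw [mul_assoc, hca, mul_one]
  · have e : star (x * c) * x + algebraMap ℝ M ε = cfc (fun t : ℝ => g t * (t * t) + ε) a := by
      rw [cfc_add_const ε (fun t => g t * (t * t)) a (hgc.mul (by fun_prop)), ← hcaa, hxx, star_mul, hcs.star_eq,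
        mul_assoc]
    rw [e]
    conv_lhs => rw [← cfc_id' ℝ a]
    refine cfc_mono (fun t ht => ?_) (by fun_prop) ((hgc.mul (by fun_prop)).add (by fun_prop))
    have := hspec t ht
    have h3 : g t * (t * t) + ε = (t * t + ε * (t + ε)) / (t + ε) := by
      simp only [hg]; field_simp
    rw [h3, le_div_iff₀ (by positivity)]
    nlinarith [mul_nonneg this hε.le, sq_nonneg ε]

theorem re_map_algebraMap (ε : ℝ) : (τ (algebraMap ℝ M ε)).re = ε := by
  have h1 : τ (1 : M) = 1 := τ.map_one'
  rw [Algebra.algebraMap_eq_smul_one, ← Complex.coe_smul, map_smul, h1]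
  simp

/-! ### The space `L¹(M, τ)` -/

/-- The trace norm `‖x‖₁ = τ(|x|)`. -/
noncomputable def traceNorm (x : M) : ℝ := (τ (CFC.abs x)).re

/-- `|τ(x y)| ≤ ‖y‖ ‖x‖₁`. -/
theorem norm_map_mul_le (x y : M) : ‖τ (x * y)‖ ≤ ‖y‖ * τ.traceNorm x := by
  refine le_of_forall_pos_le_add fun δ hδ => ?_
  set ε := δ / (‖y‖ + 1) with hε
  have hε0 : 0 < ε := by positivity
  obtain ⟨u, hu, hx, -⟩ := exists_approx_polar x hε0
  have hnn : 0 ≤ CFC.abs x + algebraMap ℝ M ε :=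
    add_nonneg (CFC.abs_nonneg x) (algebraMap_nonneg M hε0.le)
  have hyu : ‖y * u‖ ≤ ‖y‖ :=
    (norm_mul_le y u).trans (mul_le_of_le_one_right (norm_nonneg _) hu)
  have hre : 0 ≤ (τ (CFC.abs x + algebraMap ℝ M ε)).re := by simpa using τ.mono hnn
  have e : τ (x * y) = τ ((CFC.abs x + algebraMap ℝ M ε) * (y * u)) := by
    conv_lhs => rw [hx]
    rw [mul_assoc, τ.map_mul_comm, mul_assoc]
  rw [e]
  refine (τ.norm_map_mul_le_of_nonneg hnn _).trans ?_
  refine (mul_le_mul_of_nonneg_right hyu hre).trans ?_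
  rw [map_add, Complex.add_re, re_map_algebraMap, mul_add]
  have : ‖y‖ * ε ≤ δ := by
    rw [hε, mul_div_assoc', div_le_iff₀ (by positivity)]
    nlinarith [norm_nonneg y]
  have h6 : ‖y‖ * (τ (CFC.abs x)).re = ‖y‖ * τ.traceNorm x := rfl
  linarith

theorem traceNorm_add_le (x y : M) : τ.traceNorm (x + y) ≤ τ.traceNorm x + τ.traceNorm y := by
  refine le_of_forall_pos_le_add fun ε hε => ?_
  obtain ⟨u, hu, -, hle⟩ := exists_approx_polar (x + y) hε
  have hb : ∀ z : M, 0 ≤ τ.traceNorm z ∧ (τ (star u * z)).re ≤ τ.traceNorm z := by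
    intro z
    have h0 : 0 ≤ τ.traceNorm z := by simpa [traceNorm] using τ.mono (CFC.abs_nonneg z)
    refine ⟨h0, (Complex.re_le_norm _).trans ?_⟩
    rw [τ.map_mul_comm]
    refine (τ.norm_map_mul_le z (star u)).trans ?_
    rw [norm_star]
    exact mul_le_of_le_one_left h0 hu
  have h := τ.mono hle
  rw [map_add, Complex.add_re, re_map_algebraMap, mul_add, map_add, Complex.add_re] at h
  have := (hb x).2
  have := (hb y).2
  have h7 : (τ (CFC.abs (x + y))).re = τ.traceNorm (x + y) := rfl
  linarith

theorem eq_zero_of_traceNorm_eq_zero {x : M} (h : τ.traceNorm x = 0) : x = 0 := by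
  have hb := τ.norm_map_mul_le x (star x)
  rw [h, mul_zero] at hb
  have h1 : τ (star x * x) = 0 := by
    rw [τ.map_mul_comm]; exact norm_le_zero_iff.mp hb
  exact τ.faithful' x h1

theorem traceNorm_smul (c : ℂ) (x : M) : τ.traceNorm (c • x) = ‖c‖ * τ.traceNorm x := by
  rw [traceNorm, CFC.abs_smul, ← Complex.coe_smul, map_smul, smul_eq_mul, Complex.re_ofReal_mul]
  rfl

set_option linter.unusedVariables false in
/-- The vector space `M`, to be equipped with the norm `‖·‖₁` instead of its own norm. -/
def PreL1 (τ : TraceState M) : Type _ := M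

noncomputable instance : AddCommGroup τ.PreL1 := inferInstanceAs (AddCommGroup M)

noncomputable instance : Module ℂ τ.PreL1 := inferInstanceAs (Module ℂ M)

/-- The identity map from `M` to `M` with the norm `‖·‖₁`. -/
noncomputable def toPreL1 : M ≃ₗ[ℂ] τ.PreL1 := LinearEquiv.refl ℂ M

/-- `M` with the norm `‖x‖₁ = τ(|x|)`. -/
noncomputable instance : NormedAddCommGroup τ.PreL1 :=
  AddGroupNorm.toNormedAddCommGroup
    { toFun := fun x => τ.traceNorm (τ.toPreL1.symm x)
      map_zero' := by simp [traceNorm]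
      add_le' := fun x y => by simpa using τ.traceNorm_add_le _ _
      neg' := fun x => by simp [traceNorm]
      eq_zero_of_map_eq_zero' := fun x h => by
        simpa using τ.eq_zero_of_traceNorm_eq_zero h }

theorem norm_toPreL1 (x : M) : ‖τ.toPreL1 x‖ = τ.traceNorm x := rfl

noncomputable instance : NormedSpace ℂ τ.PreL1 where
  norm_smul_le c x := (τ.traceNorm_smul c (τ.toPreL1.symm x)).le

/-- `L¹(M, τ)`: the completion of `M` with respect to the norm `‖x‖₁ = τ(|x|)`. -/
abbrev L1 : Type _ := UniformSpace.Completion τ.PreL1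

/-- The inclusion of `M` into `L¹(M, τ)`. -/
noncomputable def toL1 (x : M) : τ.L1 := (τ.toPreL1 x : τ.L1)

/-- `L¹(M_h, τ)`: the `L¹`-closure of the self-adjoint elements of `M`. -/
def hermitianL1 : Set τ.L1 := closure (τ.toL1 '' {x | IsSelfAdjoint x})

/-- The functional `T ↦ τ(T K)` on `L¹(M, τ)`, for `K ∈ M`: the continuous extension of
`x ↦ τ(x K)` from `M` to `L¹(M, τ)`. -/
noncomputable def pairing (K : M) : τ.L1 →L[ℂ] ℂ :=
  ((LinearMap.mkContinuous
    (τ.toLinearMap ∘ₗ LinearMap.mulRight ℂ K ∘ₗ τ.toPreL1.symm.toLinearMap) ‖K‖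
    fun x => τ.norm_map_mul_le (τ.toPreL1.symm x) K) : τ.PreL1 →L[ℂ] ℂ).fromCompletion

theorem pairing_toL1 (K x : M) : τ.pairing K (τ.toL1 x) = τ (x * K) :=
  ContinuousLinearMap.fromCompletion_apply_coe _ _

end TraceState

end TraceState

/-! ### Cyclic gradients of noncommutative polynomials -/

section CyclicGradient

/-- The `j`-th partial cyclic derivative on `ℂ⟨X₁, …, Xₙ⟩`: the linear map sending a monomial
`X_{i₁} ⋯ X_{iₚ}` to the sum, over the positions `k` with `i_k = j`, of
`X_{i_{k+1}} ⋯ X_{iₚ} X_{i₁} ⋯ X_{i_{k-1}}`. -/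
noncomputable def cyclicDerivative {n : ℕ} (j : Fin n) :
    FreeAlgebra ℂ (Fin n) →ₗ[ℂ] FreeAlgebra ℂ (Fin n) :=
  (FreeAlgebra.basisFreeMonoid ℂ (Fin n)).constr ℂ fun w =>
    ∑ k : Fin w.toList.length, if w.toList.get k = j then
      ((w.toList.drop (k + 1) ++ w.toList.take k).map (FreeAlgebra.ι ℂ)).prod else 0

/-- The set of cyclic gradients evaluated at an `n`-tuple `Y` of elements of an algebra. -/
def cyclicGradients {M : Type*} [Ring M] [Algebra ℂ M] {n : ℕ} (Y : Fin n → M) :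
    Set (Fin n → M) :=
  Set.range fun P : FreeAlgebra ℂ (Fin n) => fun j => FreeAlgebra.lift ℂ Y (cyclicDerivative j P)

end CyclicGradient

/-! ### Independence and free independence -/

section Independence

variable {M : Type*} [CStarAlgebra M] [PartialOrder M] [StarOrderedRing M]

/-- Independence of two unital subalgebras: they commute and the trace factorizes. -/
def IsIndependent (τ : TraceState M) (S T : Subalgebra ℂ M) : Prop :=
  (∀ s ∈ S, ∀ t ∈ T, s * t = t * s) ∧ ∀ s ∈ S, ∀ t ∈ T, τ (s * t) = τ s * τ t

/-- Free independence of two unital subalgebras `S` and `T`: a nonempty product of centered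
elements taken alternately from `S` (tag `false`) and `T` (tag `true`) is centered. -/
def IsFreelyIndependent (τ : TraceState M) (S T : Subalgebra ℂ M) : Prop :=
  ∀ l : List (Bool × M), l ≠ [] → (l.map Prod.fst).IsChain (· ≠ ·) →
    (∀ x ∈ l, x.2 ∈ (if x.1 then T else S) ∧ τ x.2 = 0) → τ (l.map Prod.snd).prod = 0

end Independence

/-! ### Cyclomorphic maps -/

section Cyclomorphic

variable {M : Type*} [CStarAlgebra M] [PartialOrder M] [StarOrderedRing M]
variable {N : Type*} [CStarAlgebra N] [PartialOrder N] [StarOrderedRing N]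

/-- `f : Ω → ℝ`, with `Ω ⊆ M_hⁿ` norm-open, is `ℝ`-cyclomorphic: it is differentiable and at each
point of `Ω` its differential is `K ↦ ∑ⱼ τ(Tⱼ Kⱼ)` for some `T ∈ L¹(M_h, τ)ⁿ` in the `L¹`-closure
of the hermitian tuples of cyclic gradients. (Values of `f` outside `Ω` are irrelevant.) -/
structure IsRealCyclomorphicFun (τ : TraceState M) {n : ℕ} (Ω : Set (Fin n → selfAdjoint M))
    (f : (Fin n → selfAdjoint M) → ℝ) : Prop where
  isOpen : IsOpen Ω
  differentiableOn : DifferentiableOn ℝ f Ω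
  gradient : ∀ Y ∈ Ω, ∃ T : Fin n → τ.L1, (∀ j, T j ∈ τ.hermitianL1) ∧
    (∀ K : Fin n → selfAdjoint M,
      ((fderiv ℝ f Y K : ℝ) : ℂ) = ∑ j, τ.pairing (K j : M) (T j)) ∧
    T ∈ closure ((fun (G : Fin n → M) j => τ.toL1 (G j)) ''
      {G | G ∈ cyclicGradients (fun j => (Y j : M)) ∧ ∀ j, IsSelfAdjoint (G j)})

/-- `F : Ω → N_hᵖ`, with `Ω ⊆ M_hⁿ` norm-open, is `ℝ`-cyclomorphic: it is differentiable and
pulls back `ℝ`-cyclomorphic functions to `ℝ`-cyclomorphic functions. -/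
structure IsRealCyclomorphic (τ : TraceState M) (ν : TraceState N) {n p : ℕ}
    (Ω : Set (Fin n → selfAdjoint M)) (F : (Fin n → selfAdjoint M) → (Fin p → selfAdjoint N)) :
    Prop where
  isOpen : IsOpen Ω
  differentiableOn : DifferentiableOn ℝ F Ω
  comp : ∀ (ω : Set (Fin p → selfAdjoint N)) (f : (Fin p → selfAdjoint N) → ℝ),
    IsRealCyclomorphicFun ν ω f → IsRealCyclomorphicFun τ (Ω ∩ F ⁻¹' ω) (f ∘ F)

/-- `h : Θ → ℂ`, with `Θ ⊆ Mⁿ` norm-open, is `ℂ`-cyclomorphic: it is complex-analytic and at each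
point of `Θ` its differential is `W ↦ ∑ⱼ τ(Sⱼ Wⱼ)` for some `S ∈ L¹(M, τ)ⁿ` in the `L¹`-closure
of the cyclic gradients. -/
structure IsComplexCyclomorphicFun (τ : TraceState M) {n : ℕ} (Θ : Set (Fin n → M))
    (h : (Fin n → M) → ℂ) : Prop where
  isOpen : IsOpen Θ
  analyticOnNhd : AnalyticOnNhd ℂ h Θ
  gradient : ∀ Z ∈ Θ, ∃ S : Fin n → τ.L1,
    (∀ W : Fin n → M, fderiv ℂ h Z W = ∑ j, τ.pairing (W j) (S j)) ∧
    S ∈ closure ((fun (G : Fin n → M) j => τ.toL1 (G j)) '' cyclicGradients Z)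

/-- `H : Θ → Nᵖ`, with `Θ ⊆ Mⁿ` norm-open, is `ℂ`-cyclomorphic: it is complex-analytic and
pulls back `ℂ`-cyclomorphic functions to `ℂ`-cyclomorphic functions. -/
structure IsComplexCyclomorphic (τ : TraceState M) (ν : TraceState N) {n p : ℕ}
    (Θ : Set (Fin n → M)) (H : (Fin n → M) → (Fin p → N)) : Prop where
  isOpen : IsOpen Θ
  analyticOnNhd : AnalyticOnNhd ℂ H Θ
  comp : ∀ (θ : Set (Fin p → N)) (h : (Fin p → N) → ℂ),
    IsComplexCyclomorphicFun ν θ h → IsComplexCyclomorphicFun τ (Θ ∩ H ⁻¹' θ) (h ∘ H)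

end Cyclomorphic

/-! ### The maps adjoining a fixed tuple -/

section Adjoin

variable {A B : Type*} [CStarAlgebra A] [CStarAlgebra B]

/-- `Φ_Z : A_hⁿ → B_hⁿ⁺ᵐ`, `(Y₁, …, Yₙ) ↦ (Y₁, …, Yₙ, Z₁, …, Zₘ)`, for an inclusion `ι : A → B`. -/
def adjoinHermitian (ι : A →⋆ₐ[ℂ] B) {n m : ℕ} (Z : Fin m → selfAdjoint B)
    (Y : Fin n → selfAdjoint A) : Fin (n + m) → selfAdjoint B :=
  Fin.append (fun j => ⟨ι (Y j), (Y j).2.map ι⟩) Z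

/-- `Ξ_W : Aⁿ → Bⁿ⁺ᵐ`, `(Z₁, …, Zₙ) ↦ (Z₁, …, Zₙ, W₁, …, Wₘ)`, for an inclusion `ι : A → B`. -/
def adjoinTuple (ι : A →⋆ₐ[ℂ] B) {n m : ℕ} (W : Fin m → B) (Z : Fin n → A) : Fin (n + m) → B :=
  Fin.append (fun j => ι (Z j)) W

end Adjoin

/-!
The proof rests on one identity. Let `W` be independent or freely independent from `A`, and let `P`
be a noncommutative polynomial in `n + m` variables. The function `φ(Y) = β(P(Y, W))` on `Aⁿ` is a
polynomial in traces `α(q(Y))` of noncommutative polynomials `q`: for independence a word in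
`(Y, W)` splits into a word in `Y` and a word in `W`, and for free independence one merges
neighbouring factors from the same algebra and centers the factors of alternating products
(`trace_prod_mem_of_isIndependent`, `trace_prod_mem_of_isFreelyIndependent`).

By traciality the gradient of `Y ↦ α(q(Y))` is the cyclic gradient of `q`
(`hasDerivAt_trace_lift`), and by the Leibniz rule the gradient of `φ` at a fixed `Y` is then the
evaluation at `Y` of the cyclic gradient of a single polynomial `Q`, with coefficients depending on
`Y` (`cyclicallyDifferentiable`). But `φ` also has the gradient `(E_A(δⱼP(Y, W)))ⱼ`, where `E_A` is
the trace-preserving conditional expectation onto `A`. Hence `E_A(δⱼP(Y, W)) = δⱼQ(Y)` for `j ≤ n`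
(`exists_cyclicDerivative_eq`). The operator `E_A` enters only through its defining relation
`α(E_A(y) K) = β(y ι(K))`, and so does not have to be constructed: this relation determines `E_A(y)`
by faithfulness, gives self-adjointness of `E_A(y)` for self-adjoint `y`, and, by the duality of the
trace norm and the operator norm, the bound `‖E_A(y)‖₁ ≤ ‖y‖₁`.

The bound carries the identity over to `L¹`-closures by completeness of `L¹(A, α)`
(`exists_mem_closure_pairing_eq`). If `T` represents the differential of a cyclomorphic function at
`(Y, W)`, the tuple `S = (E_A(Tⱼ))ⱼ`, for `j ≤ n`, represents the differential of its composition
with the affine map that adjoins `W`, and lies in the closure of the cyclic gradients at `Y`.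
-/

/-! ### The trace norm by duality -/

namespace TraceState

variable {M : Type*} [CStarAlgebra M] [PartialOrder M] [StarOrderedRing M] (τ : TraceState M)

theorem traceNorm_nonneg (x : M) : 0 ≤ τ.traceNorm x := by
  simpa [traceNorm] using τ.mono (CFC.abs_nonneg x)

theorem apply_one : τ (1 : M) = 1 := τ.map_one'

open scoped ComplexOrder in
theorem apply_star (x : M) : τ (star x) = star (τ x) :=
  StarHomClass.map_star τ.toPositive x

/-- The trace norm of `x` is at most the norm of the functional `K ↦ τ(x K)`: an approximate polar
decomposition of `x` provides a contraction `K` that nearly attains it. -/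
theorem traceNorm_le_of_forall {x : M} {C : ℝ} (h : ∀ K : M, ‖K‖ ≤ 1 → ‖τ (x * K)‖ ≤ C) :
    τ.traceNorm x ≤ C := by
  refine le_of_forall_pos_le_add fun ε hε => ?_
  obtain ⟨u, hu, -, hle⟩ := exists_approx_polar x hε
  have h1 := τ.mono hle
  rw [map_add, Complex.add_re, re_map_algebraMap, τ.map_mul_comm] at h1
  have h2 := (Complex.re_le_norm _).trans (h (star u) (by rwa [norm_star]))
  have h3 : (τ (CFC.abs x)).re = τ.traceNorm x := rfl
  linarith

/-- A continuous version of the trace. -/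
noncomputable def toCLM : M →L[ℂ] ℂ :=
  LinearMap.mkContinuous τ.toLinearMap (τ.traceNorm 1) fun x => by
    have := τ.norm_map_mul_le 1 x
    rw [one_mul, mul_comm] at this
    exact this

theorem toCLM_apply (x : M) : τ.toCLM x = τ x := rfl

theorem dist_toL1 (x y : M) : dist (τ.toL1 x) (τ.toL1 y) = τ.traceNorm (x - y) := by
  rw [toL1, toL1, UniformSpace.Completion.dist_eq, dist_eq_norm, ← map_sub, norm_toPreL1]

theorem pairing_zero : τ.pairing 0 = 0 := by
  ext T
  refine UniformSpace.Completion.induction_on T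
    (isClosed_eq (τ.pairing 0).continuous continuous_const) fun x => ?_
  refine (τ.pairing_toL1 0 (τ.toPreL1.symm x)).trans ?_
  simp

/-- The trace separates points. -/
theorem eq_of_forall_map_mul_eq {x y : M} (h : ∀ K, τ (x * K) = τ (y * K)) : x = y := by
  rw [← sub_eq_zero]
  refine τ.faithful' _ ?_
  change τ _ = 0
  rw [τ.map_mul_comm, sub_mul, map_sub, h, sub_self]

end TraceState

/-! ### Derivatives of traces of noncommutative polynomials -/

section Derivative

variable {M : Type*} [CStarAlgebra M] [PartialOrder M] [StarOrderedRing M] (τ : TraceState M)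

theorem FreeAlgebra.basisFreeMonoid_apply {X : Type*} (w : FreeMonoid X) :
    FreeAlgebra.basisFreeMonoid ℂ X w = (w.toList.map (FreeAlgebra.ι ℂ)).prod := by
  simp [FreeAlgebra.basisFreeMonoid, FreeAlgebra.equivMonoidAlgebraFreeMonoid,
    FreeMonoid.lift_apply]

/-- Words span the free algebra. -/
theorem FreeAlgebra.mem_of_forall_word {X : Type*} (V : Submodule ℂ (FreeAlgebra ℂ X))
    (h : ∀ l : List X, (l.map (FreeAlgebra.ι ℂ)).prod ∈ V) (P : FreeAlgebra ℂ X) : P ∈ V := by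
  have h1 : Submodule.span ℂ (Set.range (FreeAlgebra.basisFreeMonoid ℂ X)) ≤ V := by
    rw [Submodule.span_le]
    rintro _ ⟨w, rfl⟩
    rw [FreeAlgebra.basisFreeMonoid_apply]
    exact h _
  rw [(FreeAlgebra.basisFreeMonoid ℂ X).span_eq] at h1
  exact h1 trivial

theorem cyclicDerivative_word {n : ℕ} (j : Fin n) (l : List (Fin n)) :
    cyclicDerivative j ((l.map (FreeAlgebra.ι ℂ)).prod) =
      ∑ k : Fin l.length, if l.get k = j then
        ((l.drop (k + 1) ++ l.take k).map (FreeAlgebra.ι ℂ)).prod else 0 := by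
  have h := (FreeAlgebra.basisFreeMonoid ℂ (Fin n)).constr_basis ℂ (fun w =>
    ∑ k : Fin w.toList.length, if w.toList.get k = j then
      ((w.toList.drop (k + 1) ++ w.toList.take k).map (FreeAlgebra.ι ℂ)).prod else 0)
    (FreeMonoid.ofList l)
  rw [FreeAlgebra.basisFreeMonoid_apply] at h
  exact h

/-- The linear form `K ↦ ∑ⱼ τ((δⱼP)(Y) Kⱼ)`. -/
noncomputable def gradientForm {n : ℕ} (P : FreeAlgebra ℂ (Fin n)) (Y K : Fin n → M) : ℂ :=
  ∑ j, τ (FreeAlgebra.lift ℂ Y (cyclicDerivative j P) * K j)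

theorem gradientForm_add {n : ℕ} (P Q : FreeAlgebra ℂ (Fin n)) (Y K : Fin n → M) :
    gradientForm τ (P + Q) Y K = gradientForm τ P Y K + gradientForm τ Q Y K := by
  simp [gradientForm, add_mul, Finset.sum_add_distrib]

theorem gradientForm_smul {n : ℕ} (c : ℂ) (P : FreeAlgebra ℂ (Fin n)) (Y K : Fin n → M) :
    gradientForm τ (c • P) Y K = c * gradientForm τ P Y K := by
  simp [gradientForm, Finset.mul_sum]

theorem gradientForm_zero {n : ℕ} (Y K : Fin n → M) : gradientForm τ 0 Y K = 0 := by
  simp [gradientForm]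

/-- The cyclic gradient of `P` is the gradient of the function `Y ↦ τ(P(Y))`, because the trace of
a product is invariant under cyclic rotation of the factors. -/
theorem hasDerivAt_trace_lift {n : ℕ} (P : FreeAlgebra ℂ (Fin n)) (Y K : Fin n → M) :
    HasDerivAt (fun t : ℂ => τ (FreeAlgebra.lift ℂ (Y + t • K) P)) (gradientForm τ P Y K) 0 := by
  let V : Submodule ℂ (FreeAlgebra ℂ (Fin n)) :=
    { carrier := {P | HasDerivAt (fun t : ℂ => τ (FreeAlgebra.lift ℂ (Y + t • K) P))
        (gradientForm τ P Y K) 0}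
      zero_mem' := by simpa [gradientForm_zero] using hasDerivAt_const (0 : ℂ) (0 : ℂ)
      add_mem' := fun {P Q} hP hQ => by
        simp only [Set.mem_ofPred_eq, map_add, gradientForm_add]
        exact hP.add hQ
      smul_mem' := fun c P hP => by
        simp only [Set.mem_ofPred_eq, map_smul, gradientForm_smul, smul_eq_mul]
        exact hP.const_mul c }
  refine FreeAlgebra.mem_of_forall_word V (fun l => ?_) P
  change HasDerivAt _ _ _
  have h1 : ∀ i ∈ l, HasFDerivAt (fun t : ℂ => Y i + t • K i)
      ((ContinuousLinearMap.id ℂ ℂ).smulRight (K i)) 0 := fun i _ =>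
    ((hasFDerivAt_id (0 : ℂ)).smul_const (K i)).const_add (Y i)
  have h2 := (τ.toCLM.hasFDerivAt.comp (0 : ℂ) (HasFDerivAt.list_prod' h1)).hasDerivAt
  refine HasDerivAt.congr_deriv (h2.congr_of_eventuallyEq (.of_forall fun t => ?_)) ?_
  · simp [map_list_prod, Function.comp_def, τ.toCLM_apply]
  · simp only [gradientForm, cyclicDerivative_word, map_sum, Finset.sum_mul]
    rw [Finset.sum_comm]
    simp only [ContinuousLinearMap.comp_apply, sum_apply, map_sum]
    refine Finset.sum_congr rfl fun k _ => ?_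
    rw [Finset.sum_eq_single (l.get k) (fun j _ hj => by rw [if_neg hj.symm]; simp) (by simp)]
    rw [if_pos rfl]
    simp [τ.toCLM_apply, map_list_prod, Function.comp_def]
    rw [τ.map_mul_comm, mul_assoc, mul_assoc, τ.map_mul_comm]
    simp [mul_assoc]

end Derivative

/-! ### Functions with a cyclic gradient -/

section TracePolynomials

variable {M : Type*} [CStarAlgebra M] [PartialOrder M] [StarOrderedRing M] (τ : TraceState M)

/-- The algebra of functions on `Mⁿ` whose differential at each point `Y` is
`K ↦ ∑ⱼ τ((δⱼQ)(Y) Kⱼ)` for a noncommutative polynomial `Q`, which may depend on `Y`.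
Differentials are taken along complex lines. -/
def cyclicallyDifferentiable (n : ℕ) : Subalgebra ℂ ((Fin n → M) → ℂ) where
  carrier := {φ | ∀ Y, ∃ Q : FreeAlgebra ℂ (Fin n), ∀ K,
    HasDerivAt (fun t : ℂ => φ (Y + t • K)) (gradientForm τ Q Y K) 0}
  mul_mem' := fun {φ ψ} hφ hψ Y => by
    obtain ⟨P, hP⟩ := hφ Y
    obtain ⟨Q, hQ⟩ := hψ Y
    refine ⟨ψ Y • P + φ Y • Q, fun K => ?_⟩
    refine ((hP K).mul (hQ K)).congr_deriv ?_
    simp only [gradientForm_add, gradientForm_smul, zero_smul, add_zero]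
    ring
  add_mem' := fun {φ ψ} hφ hψ Y => by
    obtain ⟨P, hP⟩ := hφ Y
    obtain ⟨Q, hQ⟩ := hψ Y
    refine ⟨P + Q, fun K => ?_⟩
    rw [gradientForm_add]
    exact (hP K).add (hQ K)
  algebraMap_mem' := fun c Y => ⟨0, fun K => by
    rw [gradientForm_zero]
    exact hasDerivAt_const _ _⟩

theorem trace_lift_mem_cyclicallyDifferentiable {n : ℕ} (P : FreeAlgebra ℂ (Fin n)) :
    (fun Y => τ (FreeAlgebra.lift ℂ Y P)) ∈ cyclicallyDifferentiable τ n :=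
  fun Y => ⟨P, fun K => hasDerivAt_trace_lift τ P Y K⟩

end TracePolynomials

/-! ### Mixed moments of two families of functions -/

section MixedMoments

section FunctionSpan

variable {X M : Type*} [Ring M] [Algebra ℂ M] (𝒯 : Subalgebra ℂ (X → ℂ))

/-- The span, with coefficients in an algebra `𝒯` of scalar functions, of an algebra `S` of
`M`-valued functions. -/
def functionSpan (S : Subalgebra ℂ (X → M)) : Submodule ℂ (X → M) :=
  Submodule.span ℂ {g | ∃ c ∈ 𝒯, ∃ s ∈ S, g = fun x => c x • s x}

variable {𝒯} {S : Subalgebra ℂ (X → M)}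

theorem smul_mem_functionSpan {c : X → ℂ} (hc : c ∈ 𝒯) {g : X → M}
    (hg : g ∈ functionSpan 𝒯 S) : (fun x => c x • g x) ∈ functionSpan 𝒯 S := by
  induction hg using Submodule.span_induction with
  | mem g hg =>
    obtain ⟨d, hd, s, hs, rfl⟩ := hg
    exact Submodule.subset_span ⟨c * d, mul_mem hc hd, s, hs, by ext x; simp [mul_smul]⟩
  | zero =>
    convert (functionSpan 𝒯 S).zero_mem using 1
    ext x
    simp
  | add g h _ _ hg hh => simpa [smul_add] using! add_mem hg hh
  | smul a g _ hg =>
    have := (functionSpan 𝒯 S).smul_mem a hg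
    convert this using 1
    ext x
    simp [smul_comm a]

theorem mem_functionSpan_of_mem {s : X → M} (hs : s ∈ S) : s ∈ functionSpan 𝒯 S :=
  Submodule.subset_span ⟨1, one_mem _, s, hs, by ext x; simp⟩

theorem mul_mem_functionSpan {g h : X → M} (hg : g ∈ functionSpan 𝒯 S)
    (hh : h ∈ functionSpan 𝒯 S) : g * h ∈ functionSpan 𝒯 S := by
  induction hg using Submodule.span_induction with
  | mem g hg =>
    obtain ⟨c, hc, s, hs, rfl⟩ := hg
    induction hh using Submodule.span_induction with
    | mem h hh =>
      obtain ⟨d, hd, t, ht, rfl⟩ := hh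
      exact Submodule.subset_span ⟨c * d, mul_mem hc hd, s * t, mul_mem hs ht, by
        ext x; simp [smul_smul, mul_comm]⟩
    | zero => simp
    | add g h _ _ hg hh => rw [mul_add]; exact add_mem hg hh
    | smul a g _ hg => rw [mul_smul_comm]; exact Submodule.smul_mem _ a hg
  | zero => simp
  | add g h _ _ hg hh => rw [add_mul]; exact add_mem hg hh
  | smul a g _ hg => rw [smul_mul_assoc]; exact Submodule.smul_mem _ a hg

theorem apply_mem_of_mem_functionSpan {R : Subalgebra ℂ M} (hS : ∀ s ∈ S, ∀ x, s x ∈ R)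
    {g : X → M} (hg : g ∈ functionSpan 𝒯 S) (x : X) : g x ∈ R := by
  induction hg using Submodule.span_induction with
  | mem g hg =>
    obtain ⟨c, hc, s, hs, rfl⟩ := hg
    exact R.smul_mem (hS s hs x) _
  | zero => exact R.zero_mem
  | add g h _ _ hg hh => exact add_mem hg hh
  | smul a g _ hg => exact R.smul_mem hg a

end FunctionSpan

variable {X M : Type*} [CStarAlgebra M] [PartialOrder M] [StarOrderedRing M] (τ : TraceState M)
  {𝒯 : Subalgebra ℂ (X → ℂ)}

theorem trace_mem_of_mem_functionSpan {S : Subalgebra ℂ (X → M)}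
    (hS : ∀ s ∈ S, (fun x => τ (s x)) ∈ 𝒯) {g : X → M}
    (hg : g ∈ functionSpan 𝒯 S) : (fun x => τ (g x)) ∈ 𝒯 := by
  induction hg using Submodule.span_induction with
  | mem g hg =>
    obtain ⟨c, hc, s, hs, rfl⟩ := hg
    simpa using! mul_mem hc (hS s hs)
  | zero =>
    convert 𝒯.zero_mem using 1
    ext x
    simp
  | add g h _ _ hg hh => simpa using! add_mem hg hh
  | smul a g _ hg => simpa using! 𝒯.smul_mem hg a

variable {R : Bool → Subalgebra ℂ M} {S : Bool → Subalgebra ℂ (X → M)}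

/-- Under free independence, the trace of a product of functions taken from two algebras is, as a
function of the point, in any algebra `𝒯` that contains the traces of the functions of each of the
two algebras. The product is shortened by merging neighbours from the same algebra; in an
alternating product each factor `g` is split into `g - τ(g)` and the scalar function `τ(g)`. -/
theorem trace_prod_mem_of_isFreelyIndependent (hR : IsFreelyIndependent τ (R false) (R true))
    (hSR : ∀ b, ∀ s ∈ S b, ∀ x, s x ∈ R b) (hS : ∀ b, ∀ s ∈ S b, (fun x => τ (s x)) ∈ 𝒯)
    (l : List (Bool × (X → M))) (hl : ∀ p ∈ l, p.2 ∈ functionSpan 𝒯 (S p.1)) :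
    (fun x => τ ((l.map Prod.snd).prod x)) ∈ 𝒯 := by
  induction hN : l.length using Nat.strong_induction_on generalizing l with
  | _ N ih =>
  by_cases hc : (l.map Prod.fst).IsChain (· ≠ ·)
  · -- `l₁` collects the factors that have been centered.
    suffices H : ∀ l₂ l₁ : List (Bool × (X → M)), (l₁ ++ l₂).length = N →
        (∀ p ∈ l₁ ++ l₂, p.2 ∈ functionSpan 𝒯 (S p.1)) →
        ((l₁ ++ l₂).map Prod.fst).IsChain (· ≠ ·) → (∀ p ∈ l₁, ∀ x, τ (p.2 x) = 0) →
        (fun x => τ (((l₁ ++ l₂).map Prod.snd).prod x)) ∈ 𝒯 from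
      H l [] hN hl hc (by simp)
    intro l₂
    induction l₂ with
    | nil =>
      intro l₁ _ hmem hch hcent
      rw [List.append_nil] at hmem hch ⊢
      by_cases h0 : l₁ = []
      · subst h0
        convert 𝒯.one_mem using 1
        ext x
        simp [τ.apply_one]
      · convert 𝒯.zero_mem using 1
        ext x
        have := hR (l₁.map fun p => (p.1, p.2 x)) (by simpa using h0)
          (by simpa [Function.comp_def] using hch) (by
            intro q hq
            obtain ⟨p, hp, rfl⟩ := List.mem_map.mp hq
            refine ⟨?_, hcent p hp x⟩
            have := apply_mem_of_mem_functionSpan (hSR p.1) (hmem p hp) x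
            cases h : p.1 <;> simpa [h] using this)
        have e : (l₁.map Prod.snd).prod x = ((l₁.map fun p => (p.1, p.2 x)).map Prod.snd).prod := by
          have h := map_list_prod (Pi.evalMonoidHom (fun _ : X => M) x) (l₁.map Prod.snd)
          rw [List.map_map] at h ⊢
          exact h
        rw [e]
        exact this
    | cons q l₂ ih₂ =>
      intro l₁ hlen hmem hch hcent
      obtain ⟨b, g⟩ := q
      have hg : g ∈ functionSpan 𝒯 (S b) := hmem (b, g) (by simp)
      have hτg := trace_mem_of_mem_functionSpan τ (hS b) hg
      have hc1 : (fun x => τ (g x) • (1 : M)) ∈ functionSpan 𝒯 (S b) :=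
        smul_mem_functionSpan hτg (mem_functionSpan_of_mem (one_mem (S b)))
      set g₀ : X → M := g - fun x => τ (g x) • (1 : M) with hg₀
      have h1 := ih₂ (l₁ ++ [(b, g₀)]) (by simpa using hlen) (by
          intro p hp
          simp only [List.append_assoc, List.mem_append, List.mem_cons, List.not_mem_nil,
            or_false] at hp
          rcases hp with hp | rfl | hp
          · exact hmem p (by simp [hp])
          · exact sub_mem hg hc1
          · exact hmem p (by simp [hp])) (by simpa using hch) (by
          intro p hp x
          rcases List.mem_append.mp hp with hp | hp
          · exact hcent p hp x
          · obtain rfl := List.mem_singleton.mp hp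
            simp [hg₀, τ.apply_one])
      have h2 := ih (l₁ ++ l₂).length (by simp at hlen ⊢; omega) (l₁ ++ l₂) (by
          intro p hp
          refine hmem p ?_
          simp only [List.mem_append, List.mem_cons] at hp ⊢
          tauto) rfl
      convert add_mem h1 (mul_mem hτg h2) using 1
      ext x
      simp [hg₀, sub_mul, mul_sub]
  · -- Two neighbours carry the same tag.
    rw [List.isChain_iff_forall_rel_of_append_cons_cons] at hc
    push Not at hc
    obtain ⟨b, b', u, v, huv, hbb⟩ := hc
    obtain ⟨l₁, l', rfl, hu, hl'⟩ := List.map_eq_append_iff.mp huv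
    obtain ⟨p, l'', rfl, hp, hl''⟩ := List.map_eq_cons_iff.mp hl'
    obtain ⟨q, l₂, rfl, hq, hv⟩ := List.map_eq_cons_iff.mp hl''
    have hpq : q.1 = p.1 := by rw [hp, hq, hbb]
    have hqm : q.2 ∈ functionSpan 𝒯 (S p.1) := hpq ▸ hl q (by simp)
    have := ih (l₁ ++ (p.1, p.2 * q.2) :: l₂).length (by simp at hN ⊢; omega)
      (l₁ ++ (p.1, p.2 * q.2) :: l₂) (by
        intro r hr
        simp only [List.mem_append, List.mem_cons] at hr
        rcases hr with hr | rfl | hr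
        · exact hl r (by simp [hr])
        · exact mul_mem_functionSpan (hl p (by simp)) hqm
        · exact hl r (by simp [hr])) rfl
    simpa [mul_assoc] using this

theorem trace_prod_mem_of_isIndependent (hR : IsIndependent τ (R false) (R true))
    (hSR : ∀ b, ∀ s ∈ S b, ∀ x, s x ∈ R b) (hS : ∀ b, ∀ s ∈ S b, (fun x => τ (s x)) ∈ 𝒯)
    (l : List (Bool × (X → M))) (hl : ∀ p ∈ l, p.2 ∈ S p.1) :
    (fun x => τ ((l.map Prod.snd).prod x)) ∈ 𝒯 := by
  have key : ∃ s ∈ S false, ∃ t ∈ S true, (l.map Prod.snd).prod = s * t := by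
    induction l with
    | nil => exact ⟨1, one_mem _, 1, one_mem _, by simp⟩
    | cons p l ih =>
      obtain ⟨s, hs, t, ht, e⟩ := ih fun q hq => hl q (by simp [hq])
      obtain ⟨b, g⟩ := p
      have hg : g ∈ S b := hl (b, g) (by simp)
      rw [List.map_cons, List.prod_cons, e]
      cases b with
      | false => exact ⟨g * s, mul_mem hg hs, t, ht, (mul_assoc _ _ _).symm⟩
      | true =>
        refine ⟨s, hs, g * t, mul_mem hg ht, ?_⟩
        have : s * g = g * s := by
          ext x
          exact hR.1 _ (hSR false s hs x) _ (hSR true g hg x)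
        rw [← mul_assoc, ← mul_assoc, this]
  obtain ⟨s, hs, t, ht, e⟩ := key
  rw [e]
  convert mul_mem (hS false s hs) (hS true t ht) using 1
  ext x
  exact hR.2 _ (hSR false s hs x) _ (hSR true t ht x)

end MixedMoments

/-! ### Cyclic gradients after adjoining an independent tuple -/

section AdjoinTuple

variable {A B : Type*} [CStarAlgebra A] [CStarAlgebra B]

@[simp]
theorem adjoinTuple_castAdd (ι : A →⋆ₐ[ℂ] B) {n m : ℕ} (W : Fin m → B) (Y : Fin n → A)
    (j : Fin n) : adjoinTuple ι W Y (Fin.castAdd m j) = ι (Y j) :=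
  Fin.append_left _ _ _

@[simp]
theorem adjoinTuple_natAdd (ι : A →⋆ₐ[ℂ] B) {n m : ℕ} (W : Fin m → B) (Y : Fin n → A)
    (j : Fin m) : adjoinTuple ι W Y (Fin.natAdd n j) = W j :=
  Fin.append_right _ _ _

theorem adjoinHermitian_coe (ι : A →⋆ₐ[ℂ] B) {n m : ℕ} (Z : Fin m → selfAdjoint B)
    (Y : Fin n → selfAdjoint A) :
    (fun i => (adjoinHermitian ι Z Y i : B)) =
      adjoinTuple ι (fun i => (Z i : B)) (fun j => (Y j : A)) := by
  ext i
  refine Fin.addCases (fun j => ?_) (fun j => ?_) i <;> simp [adjoinHermitian]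

/-- The two kinds of factors of a word in `(Y₁, …, Yₙ, W₁, …, Wₘ)`, as functions of `Y`: values of
noncommutative polynomials in `Y` (tag `false`), and constants from the algebra generated by `W`
(tag `true`). -/
noncomputable def factorAlgebra (ι : A →⋆ₐ[ℂ] B) (n : ℕ) {m : ℕ} (W : Fin m → B) :
    Bool → Subalgebra ℂ ((Fin n → A) → B)
  | false => (FreeAlgebra.lift ℂ fun (j : Fin n) (Y : Fin n → A) => ι (Y j)).range
  | true => (Algebra.adjoin ℂ (Set.range W)).map (Pi.constAlgHom ℂ (Fin n → A) B)

theorem lift_apply_eq (ι : A →⋆ₐ[ℂ] B) {n : ℕ} (P : FreeAlgebra ℂ (Fin n)) (Y : Fin n → A) :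
    FreeAlgebra.lift ℂ (fun (j : Fin n) (Y : Fin n → A) => ι (Y j)) P Y =
      ι (FreeAlgebra.lift ℂ Y P) := by
  have : (Pi.evalAlgHom ℂ (fun _ : Fin n → A => B) Y).comp
      (FreeAlgebra.lift ℂ fun (j : Fin n) (Y : Fin n → A) => ι (Y j)) =
      (ι : A →ₐ[ℂ] B).comp (FreeAlgebra.lift ℂ Y) := by
    ext j
    simp
  exact DFunLike.congr_fun this P

variable [PartialOrder A] [StarOrderedRing A] [PartialOrder B] [StarOrderedRing B]
  {α : TraceState A} {β : TraceState B} {ι : A →⋆ₐ[ℂ] B}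

theorem trace_lift_adjoinTuple_mem (hαβ : ∀ a : A, β (ι a) = α a) {n m : ℕ} {W : Fin m → B}
    (hW : IsIndependent β (AlgHom.range (ι : A →ₐ[ℂ] B)) (Algebra.adjoin ℂ (Set.range W)) ∨
      IsFreelyIndependent β (AlgHom.range (ι : A →ₐ[ℂ] B)) (Algebra.adjoin ℂ (Set.range W)))
    (P : FreeAlgebra ℂ (Fin (n + m))) :
    (fun Y => β (FreeAlgebra.lift ℂ (adjoinTuple ι W Y) P)) ∈ cyclicallyDifferentiable α n := by
  set R : Bool → Subalgebra ℂ B := fun b =>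
    cond b (Algebra.adjoin ℂ (Set.range W)) (AlgHom.range (ι : A →ₐ[ℂ] B)) with hR
  have hSR : ∀ b, ∀ s ∈ factorAlgebra ι n W b, ∀ Y, s Y ∈ R b := by
    rintro (_ | _)
    · rintro _ ⟨P, rfl⟩ Y
      exact ⟨FreeAlgebra.lift ℂ Y P, (lift_apply_eq ι P Y).symm⟩
    · rintro _ ⟨z, hz, rfl⟩ Y
      exact hz
  have hS : ∀ b, ∀ s ∈ factorAlgebra ι n W b,
      (fun Y => β (s Y)) ∈ cyclicallyDifferentiable α n := by
    rintro (_ | _)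
    · rintro _ ⟨P, rfl⟩
      convert trace_lift_mem_cyclicallyDifferentiable α P using 1
      ext Y
      rw [← hαβ, ← lift_apply_eq]
      rfl
    · rintro _ ⟨z, hz, rfl⟩
      exact (cyclicallyDifferentiable α n).algebraMap_mem (β z)
  have hprod : ∀ l : List (Bool × ((Fin n → A) → B)), (∀ p ∈ l, p.2 ∈ factorAlgebra ι n W p.1) →
      (fun Y => β ((l.map Prod.snd).prod Y)) ∈ cyclicallyDifferentiable α n := by
    intro l hl
    rcases hW with hW | hW
    · exact trace_prod_mem_of_isIndependent β (R := R) hW hSR hS l hl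
    · exact trace_prod_mem_of_isFreelyIndependent β (R := R) hW hSR hS l
        fun p hp => mem_functionSpan_of_mem (hl p hp)
  let V : Submodule ℂ (FreeAlgebra ℂ (Fin (n + m))) :=
    (Subalgebra.toSubmodule (cyclicallyDifferentiable α n)).comap
      (LinearMap.pi fun Y => β.toLinearMap ∘ₗ (FreeAlgebra.lift ℂ (adjoinTuple ι W Y)).toLinearMap)
  refine FreeAlgebra.mem_of_forall_word V (fun l => ?_) P
  let letter : Fin (n + m) → Bool × ((Fin n → A) → B) :=
    Fin.addCases (fun j => (false, fun Y => ι (Y j))) (fun j => (true, fun _ => W j))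
  have hletter : ∀ i, (letter i).2 ∈ factorAlgebra ι n W (letter i).1 := by
    intro i
    refine Fin.addCases (fun j => ?_) (fun j => ?_) i
    · simp only [letter, Fin.addCases_left]
      exact ⟨FreeAlgebra.ι ℂ j, by simp⟩
    · simp only [letter, Fin.addCases_right]
      exact ⟨W j, Algebra.subset_adjoin ⟨j, rfl⟩, rfl⟩
  have hval : ∀ i Y, (letter i).2 Y = adjoinTuple ι W Y i := by
    intro i Y
    refine Fin.addCases (fun j => ?_) (fun j => ?_) i <;> simp [letter]
  change (fun Y => β (FreeAlgebra.lift ℂ (adjoinTuple ι W Y) _)) ∈ cyclicallyDifferentiable α n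
  convert hprod (l.map letter) (by
    intro p hp
    obtain ⟨i, -, rfl⟩ := List.mem_map.mp hp
    exact hletter i) using 1
  ext Y
  have h := map_list_prod (Pi.evalMonoidHom (fun _ : Fin n → A => B) Y)
    ((l.map letter).map Prod.snd)
  rw [Pi.evalMonoidHom_apply] at h
  rw [h]
  simp [map_list_prod, Function.comp_def, hval]

/-- The conditional expectation onto `A` of a cyclic gradient at `(Y, W)` is, in its first `n`
components, a cyclic gradient at `Y`: both represent the differential of
`Y ↦ β(P(Y, W))`. -/
theorem exists_cyclicDerivative_eq (hαβ : ∀ a : A, β (ι a) = α a) {n m : ℕ} {W : Fin m → B}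
    (hW : IsIndependent β (AlgHom.range (ι : A →ₐ[ℂ] B)) (Algebra.adjoin ℂ (Set.range W)) ∨
      IsFreelyIndependent β (AlgHom.range (ι : A →ₐ[ℂ] B)) (Algebra.adjoin ℂ (Set.range W)))
    (Y : Fin n → A) {G : Fin (n + m) → B} (hG : G ∈ cyclicGradients (adjoinTuple ι W Y)) :
    ∃ H ∈ cyclicGradients Y, ∀ (j : Fin n) (K : A), α (H j * K) = β (G (Fin.castAdd m j) * ι K) := by
  obtain ⟨P, rfl⟩ := hG
  obtain ⟨Q, hQ⟩ := trace_lift_adjoinTuple_mem hαβ hW P Y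
  refine ⟨_, ⟨Q, rfl⟩, fun j K => ?_⟩
  have h1 := hQ (Pi.single j K)
  have h2 := hasDerivAt_trace_lift β P (adjoinTuple ι W Y)
    (adjoinTuple ι (0 : Fin m → B) (Pi.single j K))
  have e : ∀ t : ℂ, adjoinTuple ι W Y + t • adjoinTuple ι (0 : Fin m → B) (Pi.single j K) =
      adjoinTuple ι W (Y + t • (Pi.single j K : Fin n → A)) := by
    intro t
    ext i
    refine Fin.addCases (fun k => ?_) (fun k => ?_) i <;> simp
  simp only [e] at h2
  have h3 := h1.unique h2
  rw [gradientForm, gradientForm, Fin.sum_univ_add] at h3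
  rw [Finset.sum_eq_single j (fun k _ hk => by simp [hk]) (by simp),
    Finset.sum_eq_single j (fun k _ hk => by simp [hk]) (by simp)] at h3
  simpa using h3

end AdjoinTuple

/-! ### Passage to the `L¹`-closure -/

section Closure

variable {A B : Type*} [CStarAlgebra A] [PartialOrder A] [StarOrderedRing A]
  [CStarAlgebra B] [PartialOrder B] [StarOrderedRing B]
  {α : TraceState A} {β : TraceState B} {ι : A →⋆ₐ[ℂ] B}

/-- The conditional expectation is a contraction for the trace norms. -/
theorem traceNorm_le_of_forall_map_mul_eq {x : A} {y : B}
    (h : ∀ K, α (x * K) = β (y * ι K)) : α.traceNorm x ≤ β.traceNorm y := by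
  refine α.traceNorm_le_of_forall fun K hK => ?_
  rw [h]
  refine (β.norm_map_mul_le _ _).trans (mul_le_of_le_one_left (β.traceNorm_nonneg y) ?_)
  exact (NonUnitalStarAlgHom.norm_apply_le ι K).trans hK

/-- The conditional expectation preserves self-adjointness. -/
theorem isSelfAdjoint_of_forall_map_mul_eq {x : A} {y : B}
    (h : ∀ K, α (x * K) = β (y * ι K)) (hy : IsSelfAdjoint y) : IsSelfAdjoint x := by
  refine α.eq_of_forall_map_mul_eq fun K => ?_
  have h1 := congrArg star (h (star K))
  rw [← α.apply_star, ← β.apply_star, star_mul, star_mul, star_star, map_star, star_star,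
    hy.star_eq, β.map_mul_comm, ← h, α.map_mul_comm] at h1
  exact h1

/-- If each tuple of `R` has a tuple of conditional expectations in `C`, then so has each tuple of
the `L¹`-closure of `R`, in the `L¹`-closure of `C`. -/
theorem exists_mem_closure_pairing_eq {n m : ℕ} {R : Set (Fin (n + m) → B)} {C : Set (Fin n → A)}
    (hRC : ∀ G ∈ R, ∃ H ∈ C, ∀ (j : Fin n) (K : A), α (H j * K) = β (G (Fin.castAdd m j) * ι K))
    {T : Fin (n + m) → β.L1}
    (hT : T ∈ closure ((fun (G : Fin (n + m) → B) j => β.toL1 (G j)) '' R)) :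
    ∃ S ∈ closure ((fun (H : Fin n → A) j => α.toL1 (H j)) '' C),
      ∀ j K, α.pairing K (S j) = β.pairing (ι K) (T (Fin.castAdd m j)) := by
  obtain ⟨u, hu, hlim⟩ := mem_closure_iff_seq_limit.mp hT
  choose G hG hGu using hu
  choose H hH hHG using fun k => hRC (G k) (hG k)
  obtain rfl : (fun k j => β.toL1 (G k j)) = u := funext hGu
  have hcauchy : CauchySeq fun k j => α.toL1 (H k j) := by
    have hc := hlim.cauchySeq
    rw [Metric.cauchySeq_iff] at hc ⊢
    intro ε hε
    obtain ⟨N, hN⟩ := hc ε hε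
    refine ⟨N, fun k hk l hl => lt_of_le_of_lt ?_ (hN k hk l hl)⟩
    refine (dist_pi_le_iff dist_nonneg).mpr fun j => ?_
    refine le_trans ?_ (dist_le_pi_dist _ _ (Fin.castAdd m j))
    rw [TraceState.dist_toL1, TraceState.dist_toL1]
    refine traceNorm_le_of_forall_map_mul_eq (ι := ι) fun K => ?_
    rw [sub_mul, sub_mul, map_sub, map_sub, hHG, hHG]
  obtain ⟨S, hS⟩ := cauchySeq_tendsto_of_complete hcauchy
  refine ⟨S, mem_closure_of_tendsto hS (.of_forall fun k => ⟨H k, hH k, rfl⟩), fun j K => ?_⟩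
  have h1 := ((α.pairing K).continuous.tendsto _).comp (tendsto_pi_nhds.mp hS j)
  have h2 := ((β.pairing (ι K)).continuous.tendsto _).comp
    (tendsto_pi_nhds.mp hlim (Fin.castAdd m j))
  refine tendsto_nhds_unique h1 (h2.congr fun k => ?_)
  simp only [Function.comp_apply, TraceState.pairing_toL1, hHG]

end Closure

/-! ### Differentials of the maps adjoining a tuple -/

section Differential

variable {𝕜 V W : Type*} [NontriviallyNormedField 𝕜] [NormedAddCommGroup V] [NormedSpace 𝕜 V]
  [NormedAddCommGroup W] [NormedSpace 𝕜 W]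

/-- The linear map `(v₁, …, vₙ) ↦ (l v₁, …, l vₙ, 0, …, 0)`. -/
def appendZeroCLM (l : V →L[𝕜] W) (n m : ℕ) : (Fin n → V) →L[𝕜] (Fin (n + m) → W) :=
  ContinuousLinearMap.pi
    (Fin.addCases (fun j => l.comp (ContinuousLinearMap.proj j)) fun _ => 0)

@[simp]
theorem appendZeroCLM_castAdd (l : V →L[𝕜] W) {n m : ℕ} (v : Fin n → V) (j : Fin n) :
    appendZeroCLM l n m v (Fin.castAdd m j) = l (v j) := by
  simp [appendZeroCLM]

@[simp]
theorem appendZeroCLM_natAdd (l : V →L[𝕜] W) {n m : ℕ} (v : Fin n → V) (j : Fin m) :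
    appendZeroCLM l n m v (Fin.natAdd n j) = 0 := by
  simp [appendZeroCLM]

theorem append_eq_appendZeroCLM_add (l : V →L[𝕜] W) {n m : ℕ} (c : Fin m → W) :
    (fun v : Fin n → V => Fin.append (fun j => l (v j)) c) =
      fun v => appendZeroCLM l n m v + Fin.append (0 : Fin n → W) c := by
  ext v i
  refine Fin.addCases (fun j => ?_) (fun j => ?_) i <;> simp

theorem hasFDerivAt_append (l : V →L[𝕜] W) {n m : ℕ} (c : Fin m → W) (v : Fin n → V) :
    HasFDerivAt (fun v : Fin n → V => Fin.append (fun j => l (v j)) c) (appendZeroCLM l n m) v := by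
  rw [append_eq_appendZeroCLM_add]
  exact (appendZeroCLM l n m).hasFDerivAt.add_const _

theorem differentiable_append (l : V →L[𝕜] W) {n m : ℕ} (c : Fin m → W) :
    Differentiable 𝕜 (fun v : Fin n → V => Fin.append (fun j => l (v j)) c) :=
  fun v => (hasFDerivAt_append l c v).differentiableAt

theorem fderiv_comp_append {G : Type*} [NormedAddCommGroup G] [NormedSpace 𝕜 G] (l : V →L[𝕜] W)
    {n m : ℕ} (c : Fin m → W) (v : Fin n → V) {f : (Fin (n + m) → W) → G}
    (hf : DifferentiableAt 𝕜 f (Fin.append (fun j => l (v j)) c)) (K : Fin n → V) :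
    fderiv 𝕜 (f ∘ fun v : Fin n → V => Fin.append (fun j => l (v j)) c) v K =
      fderiv 𝕜 f (Fin.append (fun j => l (v j)) c) (appendZeroCLM l n m K) := by
  rw [HasFDerivAt.fderiv (hf.hasFDerivAt.comp v (hasFDerivAt_append l c v)),
    ContinuousLinearMap.comp_apply]

variable {A B : Type*} [CStarAlgebra A] [CStarAlgebra B]

/-- A star homomorphism of C⋆-algebras as a continuous linear map. -/
noncomputable def StarAlgHom.toCLM (ι : A →⋆ₐ[ℂ] B) : A →L[ℂ] B :=
  LinearMap.mkContinuous (ι : A →ₐ[ℂ] B).toLinearMap 1 fun a => by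
    rw [one_mul]
    exact NonUnitalStarAlgHom.norm_apply_le ι a

/-- A star homomorphism of C⋆-algebras as a continuous linear map between the self-adjoint parts. -/
noncomputable def StarAlgHom.selfAdjointCLM (ι : A →⋆ₐ[ℂ] B) : selfAdjoint A →L[ℝ] selfAdjoint B :=
  LinearMap.mkContinuous
    { toFun := fun a => ⟨ι a, a.2.map ι⟩
      map_add' := fun a b => Subtype.ext (map_add ι (a : A) b)
      map_smul' := fun c a => Subtype.ext (by
        simp only [selfAdjoint.val_smul, RingHom.id_apply]
        rw [← Complex.coe_smul, map_smul, Complex.coe_smul]) } 1 fun a => by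
    rw [one_mul]
    exact NonUnitalStarAlgHom.norm_apply_le ι (a : A)

theorem analyticOnNhd_adjoinTuple (ι : A →⋆ₐ[ℂ] B) {n m : ℕ} (W : Fin m → B) :
    AnalyticOnNhd ℂ (adjoinTuple ι W : (Fin n → A) → _) Set.univ := by
  refine AnalyticOnNhd.congr isOpen_univ
    (((appendZeroCLM ι.toCLM n m).analyticOnNhd _).add
      (analyticOnNhd_const (v := Fin.append (0 : Fin n → B) W))) fun Y _ => ?_
  exact (congrFun (append_eq_appendZeroCLM_add ι.toCLM W) Y).symm

theorem differentiable_adjoinHermitian (ι : A →⋆ₐ[ℂ] B) {n m : ℕ} (Z : Fin m → selfAdjoint B) :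
    Differentiable ℝ (adjoinHermitian ι Z : (Fin n → selfAdjoint A) → _) :=
  differentiable_append ι.selfAdjointCLM Z

end Differential

/-! ### The maps adjoining a tuple are cyclomorphic -/

section Cyclomorphic

variable {A B : Type*} [CStarAlgebra A] [PartialOrder A] [StarOrderedRing A]
  [CStarAlgebra B] [PartialOrder B] [StarOrderedRing B]
  {α : TraceState A} {β : TraceState B} {ι : A →⋆ₐ[ℂ] B}

theorem isComplexCyclomorphic_adjoinTuple (hαβ : ∀ a : A, β (ι a) = α a) {n m : ℕ} {W : Fin m → B}
    (hW : IsIndependent β (AlgHom.range (ι : A →ₐ[ℂ] B)) (Algebra.adjoin ℂ (Set.range W)) ∨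
      IsFreelyIndependent β (AlgHom.range (ι : A →ₐ[ℂ] B)) (Algebra.adjoin ℂ (Set.range W))) :
    IsComplexCyclomorphic α β Set.univ (adjoinTuple ι W : (Fin n → A) → (Fin (n + m) → B)) where
  isOpen := isOpen_univ
  analyticOnNhd := analyticOnNhd_adjoinTuple ι W
  comp := fun θ h hh => by
    have hF := analyticOnNhd_adjoinTuple ι (n := n) W
    have hcont : Continuous (adjoinTuple ι W : (Fin n → A) → _) :=
      continuousOn_univ.mp hF.continuousOn
    refine ⟨isOpen_univ.inter (hh.isOpen.preimage hcont), ?_, ?_⟩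
    · exact hh.analyticOnNhd.comp (hF.mono (Set.subset_univ _)) fun Y hY => hY.2
    · rintro Y ⟨-, hY⟩
      obtain ⟨T, hTd, hTc⟩ := hh.gradient _ hY
      obtain ⟨S, hSc, hS⟩ := exists_mem_closure_pairing_eq (m := m) (α := α) (ι := ι)
        (fun G hG => exists_cyclicDerivative_eq hαβ hW Y hG) hTc
      refine ⟨S, fun K => ?_, hSc⟩
      refine (fderiv_comp_append ι.toCLM W Y (hh.analyticOnNhd _ hY).differentiableAt K).trans ?_
      refine (hTd _).trans ?_
      rw [Fin.sum_univ_add]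
      simp only [appendZeroCLM_castAdd, appendZeroCLM_natAdd, hS]
      simp [TraceState.pairing_zero, StarAlgHom.toCLM]

theorem isRealCyclomorphic_adjoinHermitian (hαβ : ∀ a : A, β (ι a) = α a) {n m : ℕ}
    {Z : Fin m → selfAdjoint B}
    (hZ : IsIndependent β (AlgHom.range (ι : A →ₐ[ℂ] B))
        (Algebra.adjoin ℂ (Set.range fun i => (Z i : B))) ∨
      IsFreelyIndependent β (AlgHom.range (ι : A →ₐ[ℂ] B))
        (Algebra.adjoin ℂ (Set.range fun i => (Z i : B)))) :
    IsRealCyclomorphic α β Set.univ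
      (adjoinHermitian ι Z : (Fin n → selfAdjoint A) → (Fin (n + m) → selfAdjoint B)) where
  isOpen := isOpen_univ
  differentiableOn := (differentiable_adjoinHermitian ι Z).differentiableOn
  comp := fun ω f hf => by
    have hF := differentiable_adjoinHermitian ι (n := n) Z
    refine ⟨isOpen_univ.inter (hf.isOpen.preimage hF.continuous), ?_, ?_⟩
    · exact DifferentiableOn.comp (𝕜 := ℝ) (E := Fin n → selfAdjoint A)
        (F := Fin (n + m) → selfAdjoint B) (f := adjoinHermitian ι Z) (t := ω)
        hf.differentiableOn hF.differentiableOn fun Y hY => hY.2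
    · rintro Y ⟨-, hY⟩
      obtain ⟨T, -, hTd, hTc⟩ := hf.gradient _ hY
      rw [adjoinHermitian_coe] at hTc
      obtain ⟨S, hSc, hS⟩ := exists_mem_closure_pairing_eq (m := m) (α := α) (ι := ι)
        (C := {H | H ∈ cyclicGradients (fun j => (Y j : A)) ∧ ∀ j, IsSelfAdjoint (H j)})
        (fun G hG => by
          obtain ⟨H, hH, hHG⟩ := exists_cyclicDerivative_eq hαβ hZ (fun j => (Y j : A)) hG.1
          exact ⟨H, ⟨hH, fun j => isSelfAdjoint_of_forall_map_mul_eq (hHG j) (hG.2 _)⟩, hHG⟩) hTc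
      refine ⟨S, fun j => ?_, fun K => ?_, hSc⟩
      · refine map_mem_closure (f := fun S : Fin n → α.L1 => S j) (continuous_apply j) hSc ?_
        rintro _ ⟨H, hH, rfl⟩
        exact ⟨H j, hH.2 j, rfl⟩
      · refine (congrArg _ (fderiv_comp_append ι.selfAdjointCLM Z Y
          (hf.differentiableOn.differentiableAt (hf.isOpen.mem_nhds hY)) K)).trans ?_
        refine (hTd _).trans ?_
        rw [Fin.sum_univ_add]
        simp only [appendZeroCLM_castAdd, appendZeroCLM_natAdd, hS]
        simp [TraceState.pairing_zero, StarAlgHom.selfAdjointCLM]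

end Cyclomorphic

theorem theorem5p13 {A B : Type*}
    [CStarAlgebra A] [WStarAlgebra A] [PartialOrder A] [StarOrderedRing A]
    [CStarAlgebra B] [WStarAlgebra B] [PartialOrder B] [StarOrderedRing B]
    (α : TraceState A) (β : TraceState B)
    (ι : A →⋆ₐ[ℂ] B) (hι : Function.Injective ι) (hαβ : ∀ a : A, β (ι a) = α a) (n m : ℕ) :
    (∀ Z : Fin m → selfAdjoint B,
      (IsIndependent β (AlgHom.range (ι : A →ₐ[ℂ] B))
          (Algebra.adjoin ℂ (Set.range fun i => (Z i : B))) ∨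
        IsFreelyIndependent β (AlgHom.range (ι : A →ₐ[ℂ] B))
          (Algebra.adjoin ℂ (Set.range fun i => (Z i : B)))) →
      IsRealCyclomorphic α β Set.univ
        (adjoinHermitian ι Z : (Fin n → selfAdjoint A) → (Fin (n + m) → selfAdjoint B))) ∧
    (∀ W : Fin m → B,
      (IsIndependent β (AlgHom.range (ι : A →ₐ[ℂ] B)) (Algebra.adjoin ℂ (Set.range W)) ∨
        IsFreelyIndependent β (AlgHom.range (ι : A →ₐ[ℂ] B)) (Algebra.adjoin ℂ (Set.range W))) →
      IsComplexCyclomorphic α β Set.univ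
        (adjoinTuple ι W : (Fin n → A) → (Fin (n + m) → B))) := by
  exact ⟨fun Z hZ => isRealCyclomorphic_adjoinHermitian hαβ hZ,
    fun W hW => isComplexCyclomorphic_adjoinTuple hαβ hW⟩
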